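/- **Setting.** A slate has $K$ slots, with actions $[d_k]=\{1,\dots,d_k\}$ in slot $k$. Let $X\sim\nu$ be a context in a measurable space, let the slate $A=(A_1,\dots,A_K)$ be drawn given $X$ from a factored logging policy $\mu(a\mid x)=\prod_{k}\mu_k(a_k\mid x)$, and let the reward $R\in\mathbb R$ be drawn from a conditional law given $(X,A)$. Let $\pi(\cdot\mid x)$ be a target policy on slates, write $\pi(a_k\mid x)$ for its slot-$k$ marginal, and assume that for $\nu$-almost every $x$, $\mu_k(a_k\mid x)=0$ implies $\pi(a_k\mid x)=0$ for all $k$ and $a_k$. Put $$Y_k=\frac{\pi(A_k\mid X)}{\mu_k(A_k\mid X)},\qquad G=1+\sum_{k=1}^K(Y_k-1),\qquad \theta=\mathbb E[GR],$$ $$V^*=\inf_{w\in\mathbb R^K}\operatorname{Var}\Big(GR-\sum_{k=1}^K w_k(Y_k-1)\Big),$$ and assume $\mathbb E[(GR)^2]<\infty$ and $\mathbb E[Y_k^2]<\infty$ for all $k$. **Estimator.** Let $(X_i,A_i,R_i)$, $i\ge1$, be i.i.d. copies of $(X,A,R)$. For each $n$, split $\{1,\dots,n\}$ at random, independently of the first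 $n$ observations, into three folds $\mathcal D_0,\mathcal D_1,\mathcal D_2$, each of size $\lfloor n/3\rfloor$ or $\lceil n/3\rceil$ (the law of the split is otherwise arbitrary). Let $\mathbb E_n$ and $\mathbb E_{\mathcal D_j}$ denote sample averages over all $n$ observations and over $\mathcal D_j$ (an average over the empty set is $0$), and, with the convention $0/0=0$, let $$\hat w^{(j)}_{n,k}=\frac{\mathbb E_{\mathcal D_j}[GR(Y_k-1)]}{\mathbb E_{\mathcal D_j}[(Y_k-1)^2]},\qquad \hat\theta^*_n=\mathbb E_n[GR]-\sum_{k=1}^K\sum_{j=0}^{2}\frac{|\mathcal D_j|}{n}\,\hat w^{(j+1\bmod 3)}_{n,k}\,\mathbb E_{\mathcal D_j}[Y_k-1].$$ **Lemma 11.** 1. (Unbiasedness.) For every $n\ge1$ for which $\hat\theta^*_n$ is integrable, $\mathbb E[\hat\theta^*_n]=\theta$. Here $\hat\theta^*_n$ is integrable whenever all the weights $\hat w^{(j)}_{n,k}$ are integrable, and the weights are integrable for every $n$ if $\mathbb E\big[\tfrac{|GR|}{|Y_k-1|}\mathbf 1\{Y_k\ne1\}\big]<\infty$ for all $k$. 2.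 (Asymptotic normality.) As $n\to\infty$, $\sqrt n(\hat\theta^*_n-\theta)\to_d\mathcal N(0,V^*)$, where $\mathcal N(0,0)$ is the point mass at $0$. -/

import Mathlib

open MeasureTheory ProbabilityTheory Filter
open scoped ENNReal NNReal

namespace SlateOPE

/-- A slate picks, for every slot `k`, one of the `d k` actions of that slot. -/
abbrev Slate {K : ℕ} (d : Fin K → ℕ) : Type := ∀ k : Fin K, Fin (d k)

/-- A logged observation `((x, a), r)`: context, slate, reward. -/
abbrev Obs {K : ℕ} (𝒳 : Type*) (d : Fin K → ℕ) : Type _ := (𝒳 × Slate d) × ℝ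

section Population

variable {K : ℕ} {d : Fin K → ℕ} {𝒳 : Type*} [MeasurableSpace 𝒳]

theorem measurable_pi_slot (μ : ∀ k, Kernel 𝒳 (Fin (d k))) [∀ k, IsMarkovKernel (μ k)] :
    Measurable (fun x => Measure.pi (fun k => μ k x) : 𝒳 → Measure (Slate d)) := by
  refine Measure.measurable_of_measurable_coe _ fun s _ => ?_
  have h : ∀ x, Measure.pi (fun k => μ k x) s
      = ∑ a ∈ s.toFinite.toFinset, ∏ k, μ k x {a k} := by
    intro x
    rw [← s.toFinite.coe_toFinset, ← sum_measure_singleton]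
    simp
  simp_rw [h]
  exact Finset.measurable_sum _ fun a _ => Finset.measurable_prod _ fun k _ =>
    (μ k).measurable_coe (measurableSet_singleton _)

/-- The factored policy `μ(a ∣ x) = ∏ k, μ k (a k ∣ x)`. -/
noncomputable def factored (μ : ∀ k, Kernel 𝒳 (Fin (d k))) [∀ k, IsMarkovKernel (μ k)] :
    Kernel 𝒳 (Slate d) where
  toFun x := Measure.pi fun k => μ k x
  measurable' := measurable_pi_slot μ

instance (μ : ∀ k, Kernel 𝒳 (Fin (d k))) [∀ k, IsMarkovKernel (μ k)] :
    IsMarkovKernel (factored μ) :=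
  ⟨fun x => inferInstanceAs (IsProbabilityMeasure (Measure.pi fun k => μ k x))⟩

/-- The law of `(X, A, R)` with `X ∼ ν`, `A ∼ μ(· ∣ X)` for the factored policy `μ`, and
`R ∼ ρ(· ∣ X, A)`. -/
noncomputable def dataLaw (ν : Measure 𝒳) (μ : ∀ k, Kernel 𝒳 (Fin (d k)))
    [∀ k, IsMarkovKernel (μ k)] (ρ : Kernel (𝒳 × Slate d) ℝ) : Measure (Obs 𝒳 d) :=
  (ν ⊗ₘ factored μ) ⊗ₘ ρ

/-- The marginal probability `π(a ∣ x)` that the slate policy `π` puts action `a` in slot `k`. -/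
noncomputable def slotProb (π : Kernel 𝒳 (Slate d)) (k : Fin K) (x : 𝒳) (a : Fin (d k)) : ℝ :=
  (π x).real {b | b k = a}

variable (μ : ∀ k, Kernel 𝒳 (Fin (d k))) (π : Kernel 𝒳 (Slate d))

/-- The slot-level density ratio `Y_k = π(A_k ∣ X) / μ_k(A_k ∣ X)`. -/
noncomputable def Y (k : Fin K) (o : Obs 𝒳 d) : ℝ :=
  slotProb π k o.1.1 (o.1.2 k) / (μ k o.1.1).real {o.1.2 k}

/-- `G = 1 + ∑ k, (Y_k - 1)`. -/
noncomputable def G (o : Obs 𝒳 d) : ℝ := 1 + ∑ k, (Y μ π k o - 1)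

/-- The product `G R`. -/
noncomputable def GR (o : Obs 𝒳 d) : ℝ := G μ π o * o.2

/-- `Γ_w = G R - ∑ k, w_k (Y_k - 1)`. -/
noncomputable def Gam (w : Fin K → ℝ) (o : Obs 𝒳 d) : ℝ :=
  GR μ π o - ∑ k, w k * (Y μ π k o - 1)

/-- The estimand `θ = E[G R]`. -/
noncomputable def theta (L : Measure (Obs 𝒳 d)) : ℝ := ∫ o, GR μ π o ∂L

/-- The optimal variance `V* = inf_w Var(Γ_w)`, the infimum being over all `w ∈ ℝ^K`. -/
noncomputable def Vstar (L : Measure (Obs 𝒳 d)) : ℝ := ⨅ w : Fin K → ℝ, Var[Gam μ π w; L]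

end Population

section Estimator

variable {K : ℕ} {d : Fin K → ℕ} {𝒳 : Type*} [MeasurableSpace 𝒳] {n : ℕ}

/-- The `j`-th fold of the split `s`. -/
def fold (s : Fin n → Fin 3) (j : Fin 3) : Finset (Fin n) := {i | s i = j}

/-- The three folds are even: each has size `⌊n/3⌋` or `⌈n/3⌉`. -/
def IsEvenSplit (s : Fin n → Fin 3) : Prop :=
  ∀ j, n / 3 ≤ (fold s j).card ∧ (fold s j).card ≤ (n + 2) / 3

/-- The average of `f` over the data points with index in `D` (equal to `0` if `D` is empty). -/
noncomputable def avg (D : Finset (Fin n)) (data : Fin n → Obs 𝒳 d) (f : Obs 𝒳 d → ℝ) : ℝ :=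
  (D.card : ℝ)⁻¹ * ∑ i ∈ D, f (data i)

variable (μ : ∀ k, Kernel 𝒳 (Fin (d k))) (π : Kernel 𝒳 (Slate d))

/-- The weight of control variate `k` fitted on fold `j`. If its denominator vanishes then so does
its numerator, and the weight is `0`. -/
noncomputable def weight (s : Fin n → Fin 3) (data : Fin n → Obs 𝒳 d) (j : Fin 3) (k : Fin K) : ℝ :=
  avg (fold s j) data (fun o => GR μ π o * (Y μ π k o - 1)) /
    avg (fold s j) data (fun o => (Y μ π k o - 1) ^ 2)

/-- The cross-fitted estimator; the sum `j + 1` in `Fin 3` is taken modulo 3. -/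
noncomputable def thetaHat (s : Fin n → Fin 3) (data : Fin n → Obs 𝒳 d) : ℝ :=
  avg Finset.univ data (GR μ π) -
    ∑ k, ∑ j : Fin 3, ((fold s j).card : ℝ) / n * weight μ π s data (j + 1) k *
      avg (fold s j) data (fun o => Y μ π k o - 1)

end Estimator

end SlateOPE

/-!
For fixed weights `w`, the cross-fitted estimator is the sample mean of the residual `g - w · Z`
plus, for every fold `j` and control variate `k`, the error of the slope fitted on the fold `τ j`
times the sum of `Z k` over the fold `j`, divided by `n`.

With `w = 0` this gives unbiasedness: the fold sums are centred and independent of the slopes that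
multiply them. The individual products need not be integrable when their sum is, so the folds are
integrated out one at a time: integrating out fold `i` kills its centred sums, and replaces the
linear functional whose coefficients are the slopes of fold `i` by a deterministic one.

For the limit law, `w` is the vector of population slopes. The slope errors tend to zero in
probability by the law of large numbers, since the fold sizes tend to infinity, and the fold sums
divided by `√n` are bounded in probability by Chebyshev's inequality, so the sample mean of the
residual has the same limit as the estimator. The control variates are centred and mutually
orthogonal, hence separate regressions on each of them already minimise the residual variance.
-/

namespace CrossFit

theorem exists_forall_integral_apply_eq {α E : Type*} [MeasurableSpace α] [NormedAddCommGroup E]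
    [NormedSpace ℝ E] [FiniteDimensional ℝ E] (ρ : Measure α) (ℓ : α → E →L[ℝ] ℝ) :
    ∃ m : E →L[ℝ] ℝ, ∀ y, Integrable (fun a => ℓ a y) ρ → ∫ a, ℓ a y ∂ρ = m y := by
  let S : Submodule ℝ E :=
    { carrier := {y | Integrable (fun a => ℓ a y) ρ}
      add_mem' := fun {y y'} hy hy' => by
        simpa only [Set.mem_ofPred_eq, map_add] using Integrable.fun_add hy hy'
      zero_mem' := by simp
      smul_mem' := fun c y hy => by
        simpa only [Set.mem_ofPred_eq, map_smul] using Integrable.fun_smul c hy }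
  let m : S →ₗ[ℝ] ℝ :=
    { toFun := fun y => ∫ a, ℓ a y ∂ρ
      map_add' := fun y y' => by
        simpa only [Submodule.coe_add, map_add] using integral_add y.2 y'.2
      map_smul' := fun c y => by
        simpa only [Submodule.coe_smul, map_smul, RingHom.id_apply] using
          integral_smul c fun a => ℓ a y }
  obtain ⟨m', hm'⟩ := m.exists_extend
  exact ⟨m'.toContinuousLinearMap, fun y hy => (LinearMap.congr_fun hm' ⟨y, hy⟩).symm⟩

section CrossPairing

variable {κ : Type*} [Fintype κ] [DecidableEq κ] {U : κ → Type*} {E : Type*}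
  [NormedAddCommGroup E] [NormedSpace ℝ E] {τ : κ → κ}

/-- The sum over the blocks `j` of a functional of the block `τ j` evaluated at a vector computed
from the block `j`: the form of the correction term of a cross-fitted estimator, with the folds as
blocks. -/
def crossPairing (τ : κ → κ) (W : ∀ j, U j → E →L[ℝ] ℝ) (z : ∀ j, U j → E) (u : ∀ j, U j) : ℝ :=
  ∑ j, W (τ j) (u (τ j)) (z j (u j))

theorem crossPairing_update (hτ : ∀ j, τ j ≠ j) (W : ∀ j, U j → E →L[ℝ] ℝ) (z : ∀ j, U j → E)
    (i : κ) (u : ∀ j, U j) (v : U i) :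
    crossPairing τ W z (Function.update u i v)
      = W (τ i) (u (τ i)) (z i v) + W i v (∑ j with τ j = i, z j (u j))
        + crossPairing τ (Function.update W i 0) (Function.update z i 0) u := by
  have hterm : ∀ j, W (τ j) (Function.update u i v (τ j)) (z j (Function.update u i v j))
      = (if j = i then W (τ i) (u (τ i)) (z i v) else 0)
        + W i v (if τ j = i then z j (u j) else 0)
        + Function.update W i 0 (τ j) (u (τ j)) (Function.update z i 0 j (u j)) := by
    intro j
    rcases eq_or_ne j i with rfl | hj
    · simp [hτ j]
    rcases eq_or_ne (τ j) i with rfl | hτj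
    · simp [hj]
    · simp [hj, hτj]
  simp only [crossPairing, hterm, Finset.sum_add_distrib, map_sum, Finset.sum_filter,
    Finset.sum_ite_eq', Finset.mem_univ, if_true]

theorem crossPairing_update_const (hτ : ∀ j, τ j ≠ j) (W : ∀ j, U j → E →L[ℝ] ℝ)
    (z : ∀ j, U j → E) (i : κ) (m : E →L[ℝ] ℝ) (u : ∀ j, U j) :
    crossPairing τ (Function.update W i fun _ => m) (Function.update z i 0) u
      = m (∑ j with τ j = i, z j (u j))
        + crossPairing τ (Function.update W i 0) (Function.update z i 0) u := by
  have hsum : ∑ j with τ j = i, Function.update z i 0 j (u j) = ∑ j with τ j = i, z j (u j) :=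
    Finset.sum_congr rfl fun j hj => by
      have hji : j ≠ i := (Finset.mem_filter.1 hj).2 ▸ (hτ j).symm
      rw [Function.update_of_ne hji]
  have h := crossPairing_update hτ (Function.update W i fun _ => m) (Function.update z i 0) i u
    (u i)
  simpa [hsum] using h

variable [∀ j, MeasurableSpace (U j)] (ρ : ∀ j, Measure (U j)) [∀ j, IsProbabilityMeasure (ρ j)]

theorem measurePreserving_update (i : κ) :
    MeasurePreserving (fun p : U i × (∀ j, U j) => Function.update p.2 i p.1)
      ((ρ i).prod (Measure.pi ρ)) (Measure.pi ρ) := by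
  have hmeas : Measurable fun p : U i × (∀ j, U j) => Function.update p.2 i p.1 :=
    measurable_pi_lambda _ fun j => by
      rcases eq_or_ne j i with rfl | hj
      · simpa only [Function.update_self] using measurable_fst
      · simpa only [Function.update_of_ne hj] using by fun_prop
  refine ⟨hmeas, (Measure.pi_eq fun t ht => ?_).symm⟩
  have hpre : (fun p : U i × (∀ j, U j) => Function.update p.2 i p.1) ⁻¹' Set.univ.pi t
      = t i ×ˢ Set.univ.pi (Function.update t i Set.univ) := by
    ext p
    simp only [Set.mem_preimage, Set.mem_univ_pi, Set.mem_prod]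
    constructor
    · refine fun h => ⟨by simpa using h i, fun j => ?_⟩
      rcases eq_or_ne j i with rfl | hj
      · simp
      · simpa [hj] using h j
    · rintro ⟨hi, h⟩ j
      rcases eq_or_ne j i with rfl | hj
      · simpa using hi
      · simpa [hj] using h j
  rw [Measure.map_apply hmeas (.univ_pi ht), hpre, Measure.prod_prod, Measure.pi_pi,
    ← Finset.mul_prod_erase Finset.univ (fun j => ρ j (t j)) (Finset.mem_univ i),
    ← Finset.mul_prod_erase Finset.univ _ (Finset.mem_univ i), Function.update_self, measure_univ,
    one_mul]
  exact congrArg _ (Finset.prod_congr rfl fun j hj => by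
    rw [Function.update_of_ne (Finset.ne_of_mem_erase hj)])

variable [FiniteDimensional ℝ E] {W : ∀ j, U j → E →L[ℝ] ℝ} {z : ∀ j, U j → E}
  (hτ : ∀ j, τ j ≠ j) (hz : ∀ j, Integrable (z j) (ρ j)) (hz₀ : ∀ j, ∫ u, z j u ∂ρ j = 0)

include hτ hz hz₀

-- `W i` itself need not be integrable; only its values at `∑ j with τ j = i, z j (u j)` are, and
-- these are averaged by a single linear functional.
theorem exists_integral_crossPairing_eq (i : κ)
    (hint : Integrable (crossPairing τ W z) (Measure.pi ρ)) :
    ∃ m : E →L[ℝ] ℝ,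
      Integrable (crossPairing τ (Function.update W i fun _ => m) (Function.update z i 0))
        (Measure.pi ρ) ∧
      ∫ u, crossPairing τ W z u ∂Measure.pi ρ
        = ∫ u, crossPairing τ (Function.update W i fun _ => m) (Function.update z i 0) u
            ∂Measure.pi ρ := by
  obtain ⟨m, hm⟩ := exists_forall_integral_apply_eq (ρ i) (W i)
  have hmp := measurePreserving_update ρ i
  have hint' := hmp.integrable_comp_of_integrable hint
  have hinner : ∀ᵐ u ∂Measure.pi ρ, ∫ v, crossPairing τ W z (Function.update u i v) ∂ρ i
      = crossPairing τ (Function.update W i fun _ => m) (Function.update z i 0) u := by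
    filter_upwards [hint'.prod_left_ae] with u hu
    simp only [Function.comp_apply, crossPairing_update hτ] at hu ⊢
    set ℓ := W (τ i) (u (τ i))
    set y := ∑ j with τ j = i, z j (u j)
    set c := crossPairing τ (Function.update W i 0) (Function.update z i 0) u
    have hℓ : Integrable (fun v => ℓ (z i v)) (ρ i) := ℓ.integrable_comp (hz i)
    have hWy : Integrable (fun v => W i v y) (ρ i) :=
      ((hu.sub hℓ).sub (integrable_const c)).congr <| ae_of_all _ fun v => by
        simp only [Pi.sub_apply]
        ring
    calc ∫ v, (ℓ (z i v) + W i v y + c) ∂ρ i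
        = ℓ (∫ v, z i v ∂ρ i) + ∫ v, W i v y ∂ρ i + c := by
          rw [integral_add (hℓ.fun_add hWy) (integrable_const c), integral_add hℓ hWy,
            ℓ.integral_comp_comm (hz i), integral_const, probReal_univ, one_smul]
      _ = crossPairing τ (Function.update W i fun _ => m) (Function.update z i 0) u := by
          rw [hz₀ i, map_zero, zero_add, hm y hWy, crossPairing_update_const hτ]
  refine ⟨m, hint'.integral_prod_right.congr hinner, ?_⟩
  rw [← integral_congr_ae hinner, ← hmp.hasLaw.integral_comp hint.aestronglyMeasurable]
  exact integral_prod_symm _ hint'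

omit [DecidableEq κ] in
theorem integral_crossPairing_eq_zero (hint : Integrable (crossPairing τ W z) (Measure.pi ρ)) :
    ∫ u, crossPairing τ W z u ∂Measure.pi ρ = 0 := by
  classical
  suffices h : ∀ (S : Finset κ) (W : ∀ j, U j → E →L[ℝ] ℝ) (z : ∀ j, U j → E),
      (∀ j, Integrable (z j) (ρ j)) → (∀ j, ∫ u, z j u ∂ρ j = 0) → (∀ j ∉ S, z j = 0) →
      Integrable (crossPairing τ W z) (Measure.pi ρ) →
      ∫ u, crossPairing τ W z u ∂Measure.pi ρ = 0 from
    h Finset.univ W z hz hz₀ (fun j hj => absurd (Finset.mem_univ j) hj) hint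
  intro S
  induction S using Finset.induction_on with
  | empty =>
    intro W z _ _ hzero _
    simp [crossPairing, hzero]
  | insert i S _ ih =>
    intro W z hz hz₀ hzero hint
    obtain ⟨m, hint', heq⟩ := exists_integral_crossPairing_eq ρ hτ hz hz₀ i hint
    rw [heq]
    refine ih _ _ (fun j => ?_) (fun j => ?_) (fun j hj => ?_) hint'
    all_goals rcases eq_or_ne j i with rfl | hji
    · simp
    · simpa [hji] using hz j
    · simp
    · simpa [hji] using hz₀ j
    · simp
    · simpa [hji] using hzero j (by simp [hji, hj])

end CrossPairing

section Estimator

variable {O I κ ι : Type*}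

/-- The least-squares slope, over the sample points with index in `D`, of the regression of the
score `g` on the control variate `z` without intercept; it is `0` if `z` vanishes there. -/
noncomputable def slope (g z : O → ℝ) (D : Finset I) (x : I → O) : ℝ :=
  (∑ i ∈ D, g (x i) * z (x i)) / ∑ i ∈ D, z (x i) ^ 2

theorem abs_slope_le (g z : O → ℝ) (D : Finset I) (x : I → O) :
    |slope g z D x| ≤ ∑ i ∈ D, |g (x i) / z (x i)| := by
  have hterm : ∀ i ∈ D, |g (x i) * z (x i)| ≤ |g (x i) / z (x i)| * ∑ i ∈ D, z (x i) ^ 2 := by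
    intro i hi
    rcases eq_or_ne (z (x i)) 0 with h | h
    · simp [h]
    calc |g (x i) * z (x i)| = |g (x i) / z (x i)| * z (x i) ^ 2 := by
          rw [← abs_sq (z (x i)), ← abs_mul]
          congr 1
          field_simp
      _ ≤ _ := by
          gcongr
          exact Finset.single_le_sum (f := fun i => z (x i) ^ 2) (fun _ _ => sq_nonneg _) hi
  have hden : 0 ≤ ∑ i ∈ D, z (x i) ^ 2 := Finset.sum_nonneg fun _ _ => sq_nonneg _
  calc |slope g z D x| = |∑ i ∈ D, g (x i) * z (x i)| / ∑ i ∈ D, z (x i) ^ 2 := by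
        rw [slope, abs_div, abs_of_nonneg hden]
    _ ≤ ∑ i ∈ D, |g (x i) / z (x i)| := by
        refine div_le_of_le_mul₀ hden (Finset.sum_nonneg fun _ _ => abs_nonneg _) ?_
        rw [Finset.sum_mul]
        exact (Finset.abs_sum_le_sum_abs _ _).trans (Finset.sum_le_sum hterm)

@[fun_prop]
theorem measurable_slope [MeasurableSpace O] {g z : O → ℝ} (hg : Measurable g) (hz : Measurable z)
    (D : Finset I) : Measurable (slope g z D) := by
  unfold slope
  fun_prop

variable [Fintype ι]

/-- The score `g` corrected by the control variates `Z` with weights `w`. -/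
def residual (g : O → ℝ) (Z : ι → O → ℝ) (w : ι → ℝ) (o : O) : ℝ := g o - ∑ k, w k * Z k o

@[fun_prop]
theorem measurable_residual [MeasurableSpace O] {g : O → ℝ} {Z : ι → O → ℝ} (hg : Measurable g)
    (hZ : ∀ k, Measurable (Z k)) (w : ι → ℝ) : Measurable (residual g Z w) := by
  unfold residual
  fun_prop

variable [DecidableEq κ] [Fintype I]

/-- The `j`-th fold of the split `s`. -/
def fold (s : I → κ) (j : κ) : Finset I := {i | s i = j}

/-- The cross-fitted control variate estimator of the mean of `g`: a sample point in fold `j` is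
corrected with the slopes fitted on fold `τ j`. -/
noncomputable def crossFit (g : O → ℝ) (Z : ι → O → ℝ) (τ : κ → κ) (s : I → κ) (x : I → O) : ℝ :=
  (Fintype.card I : ℝ)⁻¹ *
    ∑ i, residual g Z (fun k => slope g (Z k) (fold s (τ (s i))) x) (x i)

theorem sum_eq_sum_fold [Fintype κ] (s : I → κ) (f : I → ℝ) : ∑ i, f i = ∑ j, ∑ i ∈ fold s j, f i :=
  (Finset.sum_fiberwise _ s f).symm

theorem crossFit_eq [Fintype κ] (g : O → ℝ) (Z : ι → O → ℝ) (τ : κ → κ) (s : I → κ) (x : I → O)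
    (w : ι → ℝ) :
    crossFit g Z τ s x = (Fintype.card I : ℝ)⁻¹ * (∑ i, residual g Z w (x i) +
      ∑ j, ∑ k, (w k - slope g (Z k) (fold s (τ j)) x) * ∑ i ∈ fold s j, Z k (x i)) := by
  have hfold : ∀ j, ∑ i ∈ fold s j, residual g Z (fun k => slope g (Z k) (fold s (τ (s i))) x) (x i)
      = ∑ i ∈ fold s j, residual g Z w (x i)
        + ∑ k, (w k - slope g (Z k) (fold s (τ j)) x) * ∑ i ∈ fold s j, Z k (x i) := by
    intro j
    simp_rw [Finset.mul_sum]
    rw [Finset.sum_comm, ← Finset.sum_add_distrib]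
    refine Finset.sum_congr rfl fun i hi => ?_
    obtain rfl : s i = j := by simpa [fold] using hi
    simp only [residual, sub_mul, Finset.sum_sub_distrib]
    ring
  rw [crossFit, sum_eq_sum_fold s, Finset.sum_congr rfl fun j _ => hfold j,
    Finset.sum_add_distrib, ← sum_eq_sum_fold s]

theorem sqrt_mul_crossFit_sub [Fintype κ] {n : ℕ} (g : O → ℝ) (Z : ι → O → ℝ) (τ : κ → κ)
    (s : Fin n → κ) (x : Fin n → O) (w : ι → ℝ) (θ : ℝ) :
    √(n : ℝ) * (crossFit g Z τ s x - θ) - (√(n : ℝ))⁻¹ * (∑ i, residual g Z w (x i) - n * θ)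
      = ∑ j, ∑ k, (w k - slope g (Z k) (fold s (τ j)) x) *
          ((√(n : ℝ))⁻¹ * ∑ i ∈ fold s j, Z k (x i)) := by
  rcases Nat.eq_zero_or_pos n with rfl | hn
  · simp
  have hpull : ∑ j, ∑ k, (w k - slope g (Z k) (fold s (τ j)) x) *
      ((√(n : ℝ))⁻¹ * ∑ i ∈ fold s j, Z k (x i)) = (√(n : ℝ))⁻¹ *
        ∑ j, ∑ k, (w k - slope g (Z k) (fold s (τ j)) x) * ∑ i ∈ fold s j, Z k (x i) := by
    simp only [Finset.mul_sum, mul_left_comm]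
  have hsq : (√(n : ℝ)) ^ 2 = n := Real.sq_sqrt n.cast_nonneg
  rw [hpull, crossFit_eq g Z τ s x w, Fintype.card_fin]
  field_simp
  rw [hsq]
  ring

theorem measurable_crossFit [MeasurableSpace O] {g : O → ℝ} {Z : ι → O → ℝ} (hg : Measurable g)
    (hZ : ∀ k, Measurable (Z k)) (τ : κ → κ) (s : I → κ) : Measurable (crossFit g Z τ s) := by
  unfold crossFit residual
  fun_prop

end Estimator

section FixedSplit

variable {O I κ ι : Type*} [Fintype I] [DecidableEq κ]

/-- The sample `x` cut into its restrictions to the folds of the split `s`; for an i.i.d. sample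
these are independent i.i.d. samples. -/
def foldData (s : I → κ) (x : I → O) (j : κ) (i : {i // s i = j}) : O := x i

theorem sum_fold (s : I → κ) (x : I → O) (j : κ) (f : O → ℝ) :
    ∑ i ∈ fold s j, f (x i) = ∑ i, f (foldData s x j i) :=
  Finset.sum_subtype (fold s j) (by simp [fold]) fun i => f (x i)

theorem slope_fold (g z : O → ℝ) (s : I → κ) (x : I → O) (j : κ) :
    slope g z (fold s j) x = slope g z Finset.univ (foldData s x j) := by
  simp only [slope, sum_fold s x j fun o => g o * z o, sum_fold s x j fun o => z o ^ 2]

/-- The linear functional whose coefficients are the slopes fitted on the sample `y`; applied to the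
fold sums of the control variates it gives the correction made to that fold. -/
noncomputable def slopeForm {J : Type*} [Fintype J] [Fintype ι] (g : O → ℝ) (Z : ι → O → ℝ)
    (y : J → O) : (ι → ℝ) →L[ℝ] ℝ :=
  ∑ k, slope g (Z k) Finset.univ y • ContinuousLinearMap.proj k

theorem crossFit_eq_sub_crossPairing [Fintype ι] [Fintype κ] (g : O → ℝ) (Z : ι → O → ℝ)
    (τ : κ → κ) (s : I → κ) (x : I → O) :
    crossFit g Z τ s x = (Fintype.card I : ℝ)⁻¹ * (∑ i, g (x i) -
      crossPairing τ (fun _ => slopeForm g Z) (fun _ y k => ∑ i, Z k (y i)) (foldData s x)) := by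
  rw [crossFit_eq g Z τ s x 0]
  simp [crossPairing, slopeForm, residual, slope_fold, sum_fold, sub_eq_add_neg]

variable [Fintype κ] [MeasurableSpace O] (L : Measure O) [IsProbabilityMeasure L]

theorem measurePreserving_foldData (s : I → κ) :
    MeasurePreserving (foldData s) (Measure.pi fun _ : I => L)
      (Measure.pi fun j => Measure.pi fun _ : {i // s i = j} => L) := by
  let glue : (∀ j, {i // s i = j} → O) → I → O := fun y i => y (s i) ⟨i, rfl⟩
  have hglue : Measurable glue := by fun_prop
  have hfold : Measurable (foldData s : (I → O) → _) := by unfold foldData; fun_prop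
  have hmap : Measure.pi (fun _ : I => L)
      = (Measure.pi fun j => Measure.pi fun _ : {i // s i = j} => L).map glue := by
    refine Measure.pi_eq fun t ht => ?_
    have hpre : glue ⁻¹' Set.univ.pi t
        = Set.univ.pi fun j => Set.univ.pi fun i : {i // s i = j} => t i := by
      ext y
      simp only [Set.mem_preimage, Set.mem_univ_pi]
      exact ⟨fun h j ⟨i, hi⟩ => by subst hi; exact h i, fun h i => h (s i) ⟨i, rfl⟩⟩
    rw [Measure.map_apply hglue (.univ_pi ht), hpre]
    simp only [Measure.pi_pi]
    exact Fintype.prod_fiberwise s fun i => L (t i)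
  refine ⟨hfold, ?_⟩
  rw [hmap, Measure.map_map hfold hglue]
  have hid : foldData s ∘ glue = id := by
    funext y j ⟨i, hi⟩
    subst hi
    rfl
  rw [hid, Measure.map_id]

variable {L}

theorem integrable_sum_comp {f : O → ℝ} (hf : Integrable f L) :
    Integrable (fun x : I → O => ∑ i, f (x i)) (Measure.pi fun _ => L) :=
  integrable_finsetSum _ fun _ _ => integrable_comp_eval hf

theorem integral_sum_comp {f : O → ℝ} (hf : Integrable f L) :
    ∫ x : I → O, ∑ i, f (x i) ∂(Measure.pi fun _ => L) = Fintype.card I * ∫ o, f o ∂L := by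
  have heval : ∀ i, ∫ x : I → O, f (x i) ∂(Measure.pi fun _ => L) = ∫ o, f o ∂L := fun _ =>
    integral_comp_eval (μ := fun _ : I => L) hf.aestronglyMeasurable
  rw [integral_finsetSum _ fun _ _ => integrable_comp_eval hf]
  simp only [heval, Finset.sum_const, Finset.card_univ, nsmul_eq_mul]

variable [Fintype ι] {g : O → ℝ} {Z : ι → O → ℝ} {τ : κ → κ}

theorem measurable_crossPairing_slopeForm (hg : Measurable g) (hZ : ∀ k, Measurable (Z k))
    (τ : κ → κ) (s : I → κ) :
    Measurable (crossPairing (U := fun j => {i // s i = j} → O) τ (fun _ => slopeForm g Z)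
      (fun _ y k => ∑ i, Z k (y i))) := by
  unfold crossPairing slopeForm
  simp only [FunLike.coe_sum, Finset.sum_apply, FunLike.coe_smul,
    Pi.smul_apply, ContinuousLinearMap.proj_apply, smul_eq_mul]
  fun_prop

theorem integral_crossPairing_foldData_eq_zero (hτ : ∀ j, τ j ≠ j) (hgm : Measurable g)
    (hZm : ∀ k, Measurable (Z k)) (hZ : ∀ k, Integrable (Z k) L) (hZ₀ : ∀ k, ∫ o, Z k o ∂L = 0)
    {s : I → κ} (hint : Integrable (fun x => crossPairing τ (fun _ => slopeForm g Z)
      (fun _ y k => ∑ i, Z k (y i)) (foldData s x)) (Measure.pi fun _ => L)) :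
    ∫ x, crossPairing τ (fun _ => slopeForm g Z) (fun _ y k => ∑ i, Z k (y i)) (foldData s x)
      ∂(Measure.pi fun _ => L) = 0 := by
  have hmp := measurePreserving_foldData L s
  have hm := (measurable_crossPairing_slopeForm hgm hZm τ s).aestronglyMeasurable
    (μ := Measure.pi fun j => Measure.pi fun _ : {i // s i = j} => L)
  refine (hmp.hasLaw.integral_comp hm).trans
    (integral_crossPairing_eq_zero _ hτ (fun j => ?_) (fun j => ?_)
      ((hmp.integrable_comp hm).1 hint))
  · exact Integrable.of_eval fun k => integrable_sum_comp (hZ k)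
  · funext k
    rw [eval_integral fun k => integrable_sum_comp (hZ k), integral_sum_comp (hZ k), hZ₀, mul_zero]
    rfl

end FixedSplit

section FixedSplitMoments

variable {O I κ ι : Type*} [Fintype I] [Finite κ] [MeasurableSpace O] {L : Measure O}
  [IsProbabilityMeasure L]

theorem indepFun_foldData (s : I → κ) {i j : κ} (hij : i ≠ j) :
    IndepFun (fun x => foldData s x i) (fun x => foldData s x j) (Measure.pi fun _ : I => L) := by
  classical
  cases nonempty_fintype κ
  have hmp := measurePreserving_foldData L s
  have hlaw : ∀ j, HasLaw (fun x => foldData s x j) (Measure.pi fun _ : {i // s i = j} => L)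
      (Measure.pi fun _ : I => L) := fun j =>
    ((measurePreserving_eval _ j).comp hmp).hasLaw
  exact ((iIndepFun_iff_hasLaw_pi_pi hlaw).2 hmp.hasLaw).indepFun hij

variable [DecidableEq κ] [Fintype ι] {g : O → ℝ} {Z : ι → O → ℝ} {τ : κ → κ}

theorem integral_crossFit [Nonempty I] (hτ : ∀ j, τ j ≠ j) (hgm : Measurable g)
    (hZm : ∀ k, Measurable (Z k)) (hg : Integrable g L) (hZ : ∀ k, Integrable (Z k) L)
    (hZ₀ : ∀ k, ∫ o, Z k o ∂L = 0) {s : I → κ}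
    (hint : Integrable (crossFit g Z τ s) (Measure.pi fun _ => L)) :
    ∫ x, crossFit g Z τ s x ∂(Measure.pi fun _ => L) = ∫ o, g o ∂L := by
  cases nonempty_fintype κ
  have hcard : (Fintype.card I : ℝ) ≠ 0 := Nat.cast_ne_zero.2 Fintype.card_ne_zero
  have hpair : Integrable (fun x => crossPairing τ (fun _ => slopeForm g Z)
      (fun _ y k => ∑ i, Z k (y i)) (foldData s x)) (Measure.pi fun _ => L) := by
    refine ((integrable_sum_comp hg).sub (hint.const_mul (Fintype.card I : ℝ))).congr
      (ae_of_all _ fun x => ?_)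
    simp only [Pi.sub_apply, crossFit_eq_sub_crossPairing, mul_inv_cancel_left₀ hcard,
      sub_sub_cancel]
  simp_rw [crossFit_eq_sub_crossPairing]
  rw [integral_const_mul, integral_sub (integrable_sum_comp hg) hpair, integral_sum_comp hg,
    integral_crossPairing_foldData_eq_zero hτ hgm hZm hZ hZ₀ hpair, sub_zero,
    inv_mul_cancel_left₀ hcard]

theorem integrable_crossFit (hτ : ∀ j, τ j ≠ j) (hgm : Measurable g)
    (hZm : ∀ k, Measurable (Z k)) (hg : Integrable g L) (hZ : ∀ k, Integrable (Z k) L) {s : I → κ}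
    (hslope : ∀ j k, Integrable (slope g (Z k) (fold s j)) (Measure.pi fun _ => L)) :
    Integrable (crossFit g Z τ s) (Measure.pi fun _ => L) := by
  cases nonempty_fintype κ
  have hprod : ∀ j k, Integrable
      (fun x => slope g (Z k) (fold s (τ j)) x * ∑ i ∈ fold s j, Z k (x i))
      (Measure.pi fun _ => L) := by
    intro j k
    refine IndepFun.integrable_mul ?_ (hslope (τ j) k)
      (integrable_finsetSum _ fun i _ => integrable_comp_eval (hZ k))
    have hind := (indepFun_foldData (L := L) s (hτ j)).comp
      (measurable_slope hgm (hZm k) Finset.univ)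
      (show Measurable fun y : {i // s i = j} → O => ∑ i, Z k (y i) by fun_prop)
    convert hind using 1
    · exact funext fun x => slope_fold g (Z k) s x (τ j)
    · exact funext fun x => sum_fold s x j (Z k)
  refine (((integrable_sum_comp hg).sub (integrable_finsetSum Finset.univ fun j _ =>
    integrable_finsetSum Finset.univ fun k _ => hprod j k)).const_mul (Fintype.card I : ℝ)⁻¹).congr
    (ae_of_all _ fun x => ?_)
  rw [crossFit_eq g Z τ s x 0]
  simp [residual, sub_eq_add_neg]

end FixedSplitMoments

section RandomIndex

variable {Ω S D : Type*} [MeasurableSpace Ω] [MeasurableSpace S] [MeasurableSingletonClass S]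
  [MeasurableSpace D] {P : Measure Ω} {A : Ω → S} {B : Ω → D} {Q : Measure D}

theorem aemeasurable_comp_of_countable [Countable S] (hA : AEMeasurable A P) (hB : AEMeasurable B P)
    {Φ : S → D → ℝ} (hΦ : ∀ s, Measurable (Φ s)) : AEMeasurable (fun ω => Φ (A ω) (B ω)) P :=
  (measurable_from_prod_countable_right (f := Function.uncurry Φ) hΦ).comp_aemeasurable
    (hA.prodMk hB)

variable [IsProbabilityMeasure P] [SFinite Q] (hA : AEMeasurable A P) (hB : HasLaw B Q P)
  (hAB : IndepFun A B P)

include hA hB hAB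

theorem measure_comp_of_indepFun [Countable S] {p : S → D → Prop}
    (hp : ∀ s, MeasurableSet {x | p s x}) :
    P {ω | p (A ω) (B ω)} = ∫⁻ ω, Q {x | p (A ω) x} ∂P := by
  have hset : MeasurableSet {q : S × D | p q.1 q.2} :=
    measurable_mem.1 (measurable_from_prod_countable_right fun s => measurable_mem.2 (hp s))
  rw [(hAB.hasLaw_prod ⟨hA, rfl⟩ hB).measure_eq (p := fun q => p q.1 q.2) hset,
    Measure.prod_apply hset, lintegral_map' (measurable_of_countable _).aemeasurable hA]
  rfl

variable {Φ : S → D → ℝ} (hΦ : ∀ s, Measurable (Φ s))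

include hΦ

theorem integrable_comp_iff_of_indepFun [Finite S] :
    Integrable (fun ω => Φ (A ω) (B ω)) P ↔ ∀ᵐ ω ∂P, Integrable (Φ (A ω)) Q := by
  have hlaw := hAB.hasLaw_prod ⟨hA, rfl⟩ hB
  have := Measure.isProbabilityMeasure_map (μ := P) hA
  have hm : AEStronglyMeasurable (Function.uncurry Φ) ((P.map A).prod Q) :=
    (measurable_from_prod_countable_right hΦ).aestronglyMeasurable
  calc Integrable (fun ω => Φ (A ω) (B ω)) P
      ↔ Integrable (Function.uncurry Φ) ((P.map A).prod Q) := by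
        rw [← hlaw.map_eq] at hm ⊢
        exact (integrable_map_measure hm hlaw.aemeasurable).symm
    _ ↔ ∀ᵐ s ∂P.map A, Integrable (Φ s) Q := by
        rw [integrable_prod_iff hm]
        exact and_iff_left .of_finite
    _ ↔ ∀ᵐ ω ∂P, Integrable (Φ (A ω)) Q :=
        ae_map_iff hA (Set.toFinite _).measurableSet

theorem integral_comp_of_indepFun [Countable S] (hint : Integrable (fun ω => Φ (A ω) (B ω)) P) :
    ∫ ω, Φ (A ω) (B ω) ∂P = ∫ ω, ∫ x, Φ (A ω) x ∂Q ∂P := by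
  have hlaw := hAB.hasLaw_prod ⟨hA, rfl⟩ hB
  have := Measure.isProbabilityMeasure_map (μ := P) hA
  have hm : AEStronglyMeasurable (Function.uncurry Φ) ((P.map A).prod Q) :=
    (measurable_from_prod_countable_right hΦ).aestronglyMeasurable
  have hint' : Integrable (Function.uncurry Φ) ((P.map A).prod Q) := by
    rw [← hlaw.map_eq] at hm ⊢
    exact (integrable_map_measure hm hlaw.aemeasurable).2 hint
  exact (hlaw.integral_comp hm).trans <| (integral_prod _ hint').trans <|
    integral_map hA (measurable_of_countable _).aestronglyMeasurable

end RandomIndex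

section InMeasure

variable {Ω ι : Type*} [MeasurableSpace Ω] {P : Measure Ω} {l : Filter ι}

theorem tendstoInMeasure_comp_const {E F H : Type*} [PseudoMetricSpace E] [PseudoMetricSpace F]
    [PseudoMetricSpace H] {f : ι → Ω → E} {g : ι → Ω → F} {a : E} {b : F} {φ : E → F → H}
    (hf : TendstoInMeasure P f l fun _ => a) (hg : TendstoInMeasure P g l fun _ => b)
    (hφ : ContinuousAt (Function.uncurry φ) (a, b)) :
    TendstoInMeasure P (fun n ω => φ (f n ω) (g n ω)) l fun _ => φ a b := by
  rw [tendstoInMeasure_iff_dist] at hf hg ⊢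
  intro ε hε
  obtain ⟨δ, hδ, h⟩ := Metric.continuousAt_iff.1 hφ ε hε
  refine tendsto_of_tendsto_of_tendsto_of_le_of_le tendsto_const_nhds
    (by simpa using (hf δ hδ).add (hg δ hδ)) (fun _ => zero_le) fun n => ?_
  refine (measure_mono fun ω hω => ?_).trans (measure_union_le _ _)
  contrapose! hω
  simp only [Set.mem_union, Set.mem_ofPred_eq, not_or, not_le] at hω ⊢
  exact h (x := (f n ω, g n ω)) (max_lt hω.1 hω.2)

theorem tendstoInMeasure_finsetSum_zero {β : Type*} (s : Finset β) {f : β → ι → Ω → ℝ}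
    (hf : ∀ i ∈ s, TendstoInMeasure P (f i) l fun _ => 0) :
    TendstoInMeasure P (fun n ω => ∑ i ∈ s, f i n ω) l fun _ => 0 := by
  classical
  induction s using Finset.induction_on with
  | empty =>
    rw [tendstoInMeasure_iff_norm]
    intro ε hε
    simpa [not_le.2 hε] using tendsto_const_nhds
  | insert i s hi ih =>
    simp_rw [Finset.sum_insert hi]
    simpa using tendstoInMeasure_comp_const (φ := fun x y => x + y)
      (hf i (Finset.mem_insert_self i s)) (ih fun j hj => hf j (Finset.mem_insert_of_mem hj))
      (by unfold Function.uncurry; fun_prop)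

/-- The family `W` is bounded in probability: `W = O_P(1)`, uniformly in the index. -/
def IsBoundedInProbability (P : Measure Ω) (W : ι → Ω → ℝ) : Prop :=
  Tendsto (fun M : ℝ => ⨆ n, P {ω | M ≤ |W n ω|}) atTop (nhds 0)

theorem isBoundedInProbability_of_measure_le {W : ι → Ω → ℝ} {C : ℝ}
    (hW : ∀ M : ℝ, 0 < M → ∀ n, P {ω | M ≤ |W n ω|} ≤ ENNReal.ofReal (C / M ^ 2)) :
    IsBoundedInProbability P W := by
  have hlim : Tendsto (fun M : ℝ => ENNReal.ofReal (C / M ^ 2)) atTop (nhds 0) := by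
    simpa using ENNReal.tendsto_ofReal
      ((tendsto_const_nhds (x := C)).div_atTop (tendsto_pow_atTop two_ne_zero))
  refine tendsto_of_tendsto_of_tendsto_of_le_of_le' tendsto_const_nhds hlim
    (Eventually.of_forall fun _ => zero_le) ?_
  filter_upwards [eventually_gt_atTop 0] with M hM using iSup_le (hW M hM)

theorem tendstoInMeasure_mul_of_isBoundedInProbability {X W : ι → Ω → ℝ}
    (hX : TendstoInMeasure P X l fun _ => 0) (hW : IsBoundedInProbability P W) :
    TendstoInMeasure P (fun n ω => X n ω * W n ω) l fun _ => 0 := by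
  rw [tendstoInMeasure_iff_norm] at hX ⊢
  simp only [sub_zero, Real.norm_eq_abs] at hX ⊢
  intro ε hε
  rw [ENNReal.tendsto_nhds_zero]
  intro η hη
  have hη' := ENNReal.half_pos hη.ne'
  obtain ⟨M, hM, hM₀⟩ :=
    ((ENNReal.tendsto_nhds_zero.1 hW _ hη').and (eventually_gt_atTop 0)).exists
  filter_upwards [ENNReal.tendsto_nhds_zero.1 (hX (ε / M) (by positivity)) _ hη'] with n hn
  have hsub : {ω | ε ≤ |X n ω * W n ω|} ⊆ {ω | ε / M ≤ |X n ω|} ∪ {ω | M ≤ |W n ω|} := by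
    intro ω hω
    contrapose! hω
    simp only [Set.mem_union, Set.mem_ofPred_eq, not_or, not_le, abs_mul] at hω ⊢
    calc |X n ω| * |W n ω| ≤ |X n ω| * M := by gcongr; exact hω.2.le
      _ < ε := (lt_div_iff₀ hM₀).1 hω.1
  calc P {ω | ε ≤ |X n ω * W n ω|}
      ≤ P {ω | ε / M ≤ |X n ω|} + P {ω | M ≤ |W n ω|} :=
        (measure_mono hsub).trans (measure_union_le _ _)
    _ ≤ η / 2 + η / 2 := add_le_add hn ((le_iSup (fun n => P {ω | M ≤ |W n ω|}) n).trans hM)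
    _ = η := ENNReal.add_halves η

theorem tendstoInMeasure_mul_of_ae_eq_zero {X W : ι → Ω → ℝ} (hW : ∀ n, W n =ᵐ[P] 0) :
    TendstoInMeasure P (fun n ω => X n ω * W n ω) l fun _ => 0 := by
  rw [tendstoInMeasure_iff_norm]
  intro ε hε
  refine tendsto_const_nhds.congr fun n => (measure_mono_null (fun ω hω => ?_) (hW n)).symm
  contrapose! hω
  have hWω : W n ω = 0 := by simpa using hω
  simp [hWω, hε]

theorem tendsto_lintegral_comp_of_tendsto_measure_le {N : ι → Ω → ℕ} {e : ℕ → ℝ≥0∞}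
    [IsProbabilityMeasure P] (hN : ∀ m, Tendsto (fun n => P {ω | N n ω ≤ m}) l (nhds 0))
    (he : Tendsto e atTop (nhds 0)) (he₁ : ∀ m, e m ≤ 1) :
    Tendsto (fun n => ∫⁻ ω, e (N n ω) ∂P) l (nhds 0) := by
  rw [ENNReal.tendsto_nhds_zero]
  intro η hη
  have hη' := ENNReal.half_pos hη.ne'
  obtain ⟨m, hm⟩ := eventually_atTop.1 (ENNReal.tendsto_nhds_zero.1 he _ hη')
  filter_upwards [ENNReal.tendsto_nhds_zero.1 (hN m) _ hη'] with n hn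
  have hle : ∀ ω, e (N n ω) ≤ {ω | N n ω ≤ m}.indicator 1 ω + η / 2 := by
    intro ω
    rcases le_or_gt (N n ω) m with h | h
    · simpa [h] using (he₁ _).trans le_self_add
    · simpa [h.not_ge] using hm _ h.le
  calc ∫⁻ ω, e (N n ω) ∂P ≤ ∫⁻ ω, ({ω | N n ω ≤ m}.indicator 1 ω + η / 2) ∂P := lintegral_mono hle
    _ = ∫⁻ ω, {ω | N n ω ≤ m}.indicator 1 ω ∂P + η / 2 := by
        rw [lintegral_add_right _ measurable_const, lintegral_const, measure_univ, mul_one]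
    _ ≤ η / 2 + η / 2 := by gcongr; exact (lintegral_indicator_one_le _).trans hn
    _ = η := ENNReal.add_halves η

end InMeasure
section Sample

variable {O Ω : Type*} [MeasurableSpace O] [MeasurableSpace Ω] {L : Measure O} {P : Measure Ω}
  {obs : ℕ → Ω → O} (hlaw : ∀ i, HasLaw (obs i) L P) (hindep : iIndepFun obs P)

include hlaw hindep

theorem hasLaw_sample (n : ℕ) :
    HasLaw (fun ω (i : Fin n) => obs i ω) (Measure.pi fun _ : Fin n => L) P :=
  (hindep.precomp Fin.val_injective).hasLaw_pi fun i => hlaw i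

theorem tendstoInMeasure_average [IsFiniteMeasure P]
    {f : O → ℝ} (hf : Measurable f) (hfi : Integrable f L) :
    TendstoInMeasure P (fun (m : ℕ) ω => (m : ℝ)⁻¹ * ∑ i ∈ Finset.range m, f (obs i ω)) atTop
      fun _ => ∫ o, f o ∂L := by
  have hmean : ∫ ω, f (obs 0 ω) ∂P = ∫ o, f o ∂L :=
    (hlaw 0).integral_comp hf.aestronglyMeasurable
  have hlln := strong_law_ae_real (fun i ω => f (obs i ω))
    (((hlaw 0).map_eq ▸ hfi).comp_aemeasurable (hlaw 0).aemeasurable)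
    (fun i j hij => (hindep.indepFun hij).comp hf hf)
    fun i => ((hlaw i).identDistrib (hlaw 0)).comp hf
  refine tendstoInMeasure_of_tendsto_ae (fun m => AEMeasurable.aestronglyMeasurable ?_) ?_
  · have := fun i => (hlaw i).aemeasurable
    fun_prop
  · filter_upwards [hlln] with ω hω
    simpa only [div_eq_inv_mul, hmean] using hω

theorem tendstoInDistribution_inv_sqrt_mul_sum_comp [IsProbabilityMeasure P] {f : O → ℝ}
    (hf : Measurable f) (hf₂ : MemLp f 2 L) :
    TendstoInDistribution (fun (n : ℕ) ω =>
        (√(n : ℝ))⁻¹ * (∑ i ∈ Finset.range n, f (obs i ω) - n * ∫ o, f o ∂L))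
      atTop id (fun _ => P) (gaussianReal 0 Var[f; L].toNNReal) := by
  have hmean : ∫ ω, f (obs 0 ω) ∂P = ∫ o, f o ∂L :=
    (hlaw 0).integral_comp hf.aestronglyMeasurable
  have hvar : Var[fun ω => f (obs 0 ω); P] = Var[f; L] := by
    rw [← (hlaw 0).map_eq, variance_map hf.aemeasurable (hlaw 0).aemeasurable]
    rfl
  have hmem : MemLp (fun ω => f (obs 0 ω)) 2 P :=
    ((hlaw 0).map_eq ▸ hf₂).comp_of_map (hlaw 0).aemeasurable
  have hclt := tendstoInDistribution_inv_sqrt_mul_sum_sub (X := fun i ω => f (obs i ω)) (Y := id)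
    (P' := gaussianReal 0 Var[f; L].toNNReal) (by rw [hvar]; exact HasLaw.id) hmem
    (hindep.comp (fun _ => f) fun _ => hf) fun i => ((hlaw i).identDistrib (hlaw 0)).comp hf
  simpa only [hmean] using hclt

end Sample

section FoldAverages

variable {O Ω κ : Type*} [MeasurableSpace O] [MeasurableSpace Ω] {L : Measure O}
  [IsProbabilityMeasure L] {P : Measure Ω} {obs : ℕ → Ω → O}

theorem variance_sum_comp {I : Type*} [Fintype I] {z : O → ℝ} (hz : MemLp z 2 L) (D : Finset I) :
    Var[fun x : I → O => ∑ i ∈ D, z (x i); Measure.pi fun _ => L] = D.card * Var[z; L] := by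
  have hmp := fun i : I => measurePreserving_eval (fun _ : I => L) i
  have hind : iIndepFun (fun (i : I) (x : I → O) => z (x i)) (Measure.pi fun _ => L) :=
    iIndepFun_pi (X := fun _ => z) fun _ => hz.aestronglyMeasurable.aemeasurable
  have hvar : ∀ i, Var[z ∘ Function.eval i; Measure.pi fun _ => L] = Var[z; L] := fun i =>
    (hmp i).variance_fun_comp hz.aestronglyMeasurable.aemeasurable
  have hsum := IndepFun.variance_sum (fun i _ => hz.comp_measurePreserving (hmp i))
    (s := D) fun i _ j _ hij => hind.indepFun hij
  calc _ = Var[∑ i ∈ D, z ∘ Function.eval i; Measure.pi fun _ => L] := by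
        congr with x
        simp
    _ = _ := by
        rw [hsum, Finset.sum_congr rfl fun i _ => hvar i, Finset.sum_const, nsmul_eq_mul]

theorem measure_le_abs_inv_sqrt_mul_sum_le {I : Type*} [Fintype I] {z : O → ℝ} (hz : MemLp z 2 L)
    (hz₀ : ∫ o, z o ∂L = 0) (D : Finset I) {M : ℝ} (hM : 0 < M) :
    (Measure.pi fun _ : I => L) {x | M ≤ |(√(Fintype.card I : ℝ))⁻¹ * ∑ i ∈ D, z (x i)|}
      ≤ ENNReal.ofReal (Var[z; L] / M ^ 2) := by
  have hmem : MemLp (fun x : I → O => (√(Fintype.card I : ℝ))⁻¹ * ∑ i ∈ D, z (x i)) 2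
      (Measure.pi fun _ => L) :=
    (memLp_finsetSum _ fun i _ =>
      hz.comp_measurePreserving (measurePreserving_eval (fun _ : I => L) i)).const_mul _
  have hmean : ∫ x : I → O, (√(Fintype.card I : ℝ))⁻¹ * ∑ i ∈ D, z (x i)
      ∂(Measure.pi fun _ => L) = 0 := by
    rw [integral_const_mul,
      integral_finsetSum _ fun i _ => integrable_comp_eval (hz.integrable one_le_two)]
    simp only [integral_comp_eval (μ := fun _ : I => L) hz.aestronglyMeasurable, hz₀,
      Finset.sum_const_zero, mul_zero]
  have hvar : Var[fun x : I → O => (√(Fintype.card I : ℝ))⁻¹ * ∑ i ∈ D, z (x i);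
      Measure.pi fun _ => L] ≤ Var[z; L] := by
    rw [variance_const_mul, variance_sum_comp hz, inv_pow, Real.sq_sqrt (Nat.cast_nonneg _),
      ← mul_assoc]
    refine mul_le_of_le_one_left (variance_nonneg _ _) ?_
    exact inv_mul_le_one_of_le₀ (mod_cast Finset.card_le_univ D) (Nat.cast_nonneg _)
  have hcheb := meas_ge_le_variance_div_sq hmem hM
  simp only [hmean, sub_zero] at hcheb
  exact hcheb.trans (ENNReal.ofReal_le_ofReal (by gcongr))

variable (hlaw : ∀ i, HasLaw (obs i) L P) (hindep : iIndepFun obs P)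

include hlaw hindep

theorem identDistrib_sum_comp {I : Type*} [Fintype I] {f : O → ℝ} (hf : Measurable f)
    (D : Finset I) :
    IdentDistrib (fun x : I → O => ∑ i ∈ D, f (x i))
      (fun ω => ∑ i ∈ Finset.range D.card, f (obs i ω)) (Measure.pi fun _ => L) P := by
  have hid : iIndepFun (fun (i : I) (x : I → O) => x i) (Measure.pi fun _ : I => L) :=
    iIndepFun_pi (X := fun _ => id) fun _ => aemeasurable_id
  have hsub : HasLaw (fun (x : I → O) (i : Fin D.card) => x (D.equivFin.symm i))
      (Measure.pi fun _ => L) (Measure.pi fun _ => L) :=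
    (hid.precomp (Subtype.val_injective.comp D.equivFin.symm.injective)).hasLaw_pi fun i =>
      (measurePreserving_eval (fun _ : I => L) (D.equivFin.symm i)).hasLaw
  have hsum : Measurable fun y : Fin D.card → O => ∑ i, f (y i) := by fun_prop
  convert (hsub.identDistrib (hasLaw_sample hlaw hindep D.card)).comp hsum using 1
  · funext x
    rw [← Finset.sum_coe_sort]
    exact (D.equivFin.symm.sum_comp fun i : D => f (x i)).symm
  · exact funext fun ω => Finset.sum_range fun i => f (obs i ω)

variable [DecidableEq κ] [Finite κ] [MeasurableSpace κ] [MeasurableSingletonClass κ]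
  [IsProbabilityMeasure P] {split : ∀ n : ℕ, Ω → Fin n → κ}
  (hsplit : ∀ n, AEMeasurable (split n) P)
  (hsplit_indep : ∀ n, IndepFun (split n) (fun ω (i : Fin n) => obs i ω) P)

include hsplit hsplit_indep

theorem isBoundedInProbability_inv_sqrt_mul_sum_fold {z : O → ℝ} (hzm : Measurable z)
    (hz : MemLp z 2 L) (hz₀ : ∫ o, z o ∂L = 0) (j : κ) :
    IsBoundedInProbability P fun (n : ℕ) ω =>
      (√(n : ℝ))⁻¹ * ∑ i ∈ fold (split n ω) j, z (obs i ω) := by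
  refine isBoundedInProbability_of_measure_le (C := Var[z; L]) fun M hM n => ?_
  rw [measure_comp_of_indepFun (hsplit n) (hasLaw_sample hlaw hindep n) (hsplit_indep n)
    (p := fun s x => M ≤ |(√(n : ℝ))⁻¹ * ∑ i ∈ fold s j, z (x i)|) fun s =>
      measurableSet_le measurable_const (by fun_prop)]
  calc _ ≤ ∫⁻ _, ENNReal.ofReal (Var[z; L] / M ^ 2) ∂P := lintegral_mono fun ω => by
        simpa only [Fintype.card_fin] using
          measure_le_abs_inv_sqrt_mul_sum_le hz hz₀ (fold (split n ω) j) hM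
    _ = _ := by rw [lintegral_const, measure_univ, mul_one]

theorem tendstoInMeasure_average_fold
    {j : κ} (hfold : ∀ m, Tendsto (fun n => P {ω | (fold (split n ω) j).card ≤ m}) atTop (nhds 0))
    {f : O → ℝ} (hf : Measurable f) (hfi : Integrable f L) :
    TendstoInMeasure P (fun n ω => ((fold (split n ω) j).card : ℝ)⁻¹ *
      ∑ i ∈ fold (split n ω) j, f (obs i ω)) atTop fun _ => ∫ o, f o ∂L := by
  rw [tendstoInMeasure_iff_norm]
  intro ε hε
  refine (tendsto_lintegral_comp_of_tendsto_measure_le hfold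
    (tendstoInMeasure_iff_norm.1 (tendstoInMeasure_average hlaw hindep hf hfi) ε hε)
    fun _ => prob_le_one).congr fun n => ?_
  rw [measure_comp_of_indepFun (hsplit n) (hasLaw_sample hlaw hindep n) (hsplit_indep n)
    (p := fun s x => ε ≤ ‖((fold s j).card : ℝ)⁻¹ * ∑ i ∈ fold s j, f (x i) - ∫ o, f o ∂L‖)
    fun s => measurableSet_le measurable_const (by fun_prop)]
  refine lintegral_congr fun ω => ?_
  have hset : MeasurableSet {r : ℝ |
      ε ≤ ‖((fold (split n ω) j).card : ℝ)⁻¹ * r - ∫ o, f o ∂L‖} :=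
    measurableSet_le measurable_const (by fun_prop)
  exact ((identDistrib_sum_comp hlaw hindep hf (fold (split n ω) j)).measure_mem_eq hset).symm

end FoldAverages

section Population

variable {O ι : Type*} [Fintype ι] [MeasurableSpace O] {L : Measure O} {g : O → ℝ} {Z : ι → O → ℝ}

/-- The population slopes of the regressions of the score `g` on each of the control variates `Z`
without intercept, which the slopes fitted on a growing sample estimate. A control variate with
vanishing second moment gets the slope `x / 0 = 0`. -/
noncomputable def regressionCoeff (g : O → ℝ) (Z : ι → O → ℝ) (L : Measure O) (k : ι) : ℝ :=
  (∫ o, g o * Z k o ∂L) / ∫ o, Z k o ^ 2 ∂L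

theorem integral_residual (hg : Integrable g L) (hZ : ∀ k, Integrable (Z k) L)
    (hZ₀ : ∀ k, ∫ o, Z k o ∂L = 0) (w : ι → ℝ) : ∫ o, residual g Z w o ∂L = ∫ o, g o ∂L := by
  unfold residual
  rw [integral_sub hg (integrable_finsetSum _ fun k _ => (hZ k).const_mul (w k)),
    integral_finsetSum _ fun k _ => (hZ k).const_mul (w k)]
  simp only [integral_const_mul, hZ₀, mul_zero, Finset.sum_const_zero, sub_zero]

variable (hg : MemLp g 2 L) (hZ : ∀ k, MemLp (Z k) 2 L)

include hg hZ

theorem memLp_residual (w : ι → ℝ) : MemLp (residual g Z w) 2 L :=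
  hg.sub (memLp_finsetSum _ fun k _ => (hZ k).const_mul (w k))

variable (hZZ : Pairwise fun k l => ∫ o, Z k o * Z l o ∂L = 0)

include hZZ

theorem integral_residual_mul_eq_zero (l : ι) :
    ∫ o, residual g Z (regressionCoeff g Z L) o * Z l o ∂L = 0 := by
  classical
  have hint : ∀ k, Integrable (fun o => regressionCoeff g Z L k * (Z k o * Z l o)) L := fun k =>
    ((hZ k).integrable_mul (hZ l)).const_mul _
  have hgZ : Integrable (fun o => g o * Z l o) L := hg.integrable_mul (hZ l)
  have hdiag : regressionCoeff g Z L l * ∫ o, Z l o ^ 2 ∂L = ∫ o, g o * Z l o ∂L := by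
    refine div_mul_cancel_of_imp fun h0 => ?_
    have hae := (integral_eq_zero_iff_of_nonneg (fun o => sq_nonneg (Z l o))
      (hZ l).integrable_sq).1 h0
    refine integral_eq_zero_of_ae (hae.mono fun o ho => ?_)
    have hZo : Z l o = 0 := by simpa using ho
    simp [hZo]
  calc ∫ o, residual g Z (regressionCoeff g Z L) o * Z l o ∂L
      = ∫ o, (g o * Z l o - ∑ k, regressionCoeff g Z L k * (Z k o * Z l o)) ∂L := by
        simp only [residual, sub_mul, Finset.sum_mul, mul_assoc]
    _ = ∫ o, g o * Z l o ∂L - ∑ k, regressionCoeff g Z L k * ∫ o, Z k o * Z l o ∂L := by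
        rw [integral_sub hgZ (integrable_finsetSum _ fun k _ => hint k),
          integral_finsetSum _ fun k _ => hint k]
        simp only [integral_const_mul]
    _ = ∫ o, g o * Z l o ∂L - regressionCoeff g Z L l * ∫ o, Z l o ^ 2 ∂L := by
        rw [Finset.sum_eq_single l (fun k _ hk => by rw [hZZ hk, mul_zero]) (by simp)]
        simp only [pow_two]
    _ = 0 := by rw [hdiag, sub_self]

theorem iInf_variance_residual [IsProbabilityMeasure L] (hZ₀ : ∀ k, ∫ o, Z k o ∂L = 0) :
    ⨅ w, Var[residual g Z w; L] = Var[residual g Z (regressionCoeff g Z L); L] := by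
  set w₀ := regressionCoeff g Z L
  refine le_antisymm (ciInf_le ⟨0, ?_⟩ _) (le_ciInf fun w => ?_)
  · rintro _ ⟨w, rfl⟩
    exact variance_nonneg _ _
  have hres := memLp_residual hg hZ w₀
  have hcorr : ∀ k, MemLp (fun o => (w k - w₀ k) * Z k o) 2 L := fun k => (hZ k).const_mul _
  have hcov : cov[residual g Z w₀, fun o => ∑ k, (w k - w₀ k) * Z k o; L] = 0 := by
    rw [covariance_fun_sum_right hcorr hres]
    refine Finset.sum_eq_zero fun k _ => ?_
    rw [covariance_const_mul_right, covariance_eq_sub hres (hZ k), hZ₀, mul_zero, sub_zero]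
    exact mul_eq_zero_of_right _ (integral_residual_mul_eq_zero hg hZ hZZ k)
  calc Var[residual g Z w₀; L]
      ≤ Var[residual g Z w₀; L] + Var[fun o => ∑ k, (w k - w₀ k) * Z k o; L] :=
        le_add_of_nonneg_right (variance_nonneg _ _)
    _ = Var[fun o => residual g Z w₀ o - ∑ k, (w k - w₀ k) * Z k o; L] := by
        rw [variance_fun_sub hres (memLp_finsetSum _ fun k _ => hcorr k), hcov, mul_zero, sub_zero]
    _ = Var[residual g Z w; L] := by
        congr with o
        simp only [residual, sub_mul, Finset.sum_sub_distrib]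
        ring

end Population

section Asymptotics

variable {O Ω κ ι : Type*} [MeasurableSpace O] [MeasurableSpace Ω] [DecidableEq κ]
  [MeasurableSpace κ] [MeasurableSingletonClass κ] {L : Measure O} [IsProbabilityMeasure L]
  {P : Measure Ω} [IsProbabilityMeasure P] {obs : ℕ → Ω → O}
  (hlaw : ∀ i, HasLaw (obs i) L P) (hindep : iIndepFun obs P)
  {split : ∀ n : ℕ, Ω → Fin n → κ} (hsplit : ∀ n, AEMeasurable (split n) P)
  (hsplit_indep : ∀ n, IndepFun (split n) (fun ω (i : Fin n) => obs i ω) P)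
  (hfold : ∀ j m, Tendsto (fun n => P {ω | (fold (split n ω) j).card ≤ m}) atTop (nhds 0))
  {g : O → ℝ} {Z : ι → O → ℝ} (hgm : Measurable g) (hZm : ∀ k, Measurable (Z k))
  (hg : MemLp g 2 L) (hZ : ∀ k, MemLp (Z k) 2 L)

include hlaw hindep hsplit hsplit_indep hfold hgm hZm hg hZ

theorem tendstoInMeasure_slope [Finite κ] {k : ι} (hk : ∫ o, Z k o ^ 2 ∂L ≠ 0) (j : κ) :
    TendstoInMeasure P (fun n ω => slope g (Z k) (fold (split n ω) j) fun i => obs i ω) atTop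
      fun _ => regressionCoeff g Z L k := by
  have hnum := tendstoInMeasure_average_fold hlaw hindep hsplit hsplit_indep (hfold j)
    (f := fun o => g o * Z k o) (hgm.mul (hZm k)) (hg.integrable_mul (hZ k))
  have hden := tendstoInMeasure_average_fold hlaw hindep hsplit hsplit_indep (hfold j)
    (f := fun o => Z k o ^ 2) ((hZm k).pow_const 2) (hZ k).integrable_sq
  refine (tendstoInMeasure_comp_const (φ := fun a b => a / b) hnum hden
    (by unfold Function.uncurry; fun_prop (disch := exact hk))).congr_left
    fun n => ae_of_all _ fun ω => ?_
  rcases (fold (split n ω) j).eq_empty_or_nonempty with h | h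
  · simp [h, slope]
  · exact mul_div_mul_left _ _ (by simpa using h.ne_empty)

theorem tendstoInMeasure_slope_error_mul [Finite κ] {k : ι} (hZ₀ : ∫ o, Z k o ∂L = 0) (i j : κ) :
    TendstoInMeasure P (fun (n : ℕ) ω =>
      (regressionCoeff g Z L k - slope g (Z k) (fold (split n ω) i) fun i => obs i ω) *
        ((√(n : ℝ))⁻¹ * ∑ i ∈ fold (split n ω) j, Z k (obs i ω))) atTop fun _ => 0 := by
  by_cases hk : ∫ o, Z k o ^ 2 ∂L = 0
  · refine tendstoInMeasure_mul_of_ae_eq_zero fun n => ?_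
    have hae : ∀ᵐ o ∂L, Z k o = 0 :=
      ((integral_eq_zero_iff_of_nonneg (fun o => sq_nonneg (Z k o))
        (hZ k).integrable_sq).1 hk).mono fun o ho => by simpa using ho
    have hobs : ∀ i, ∀ᵐ ω ∂P, Z k (obs i ω) = 0 := fun i =>
      ae_of_ae_map (hlaw i).aemeasurable ((hlaw i).map_eq ▸ hae)
    filter_upwards [ae_all_iff.2 hobs] with ω hω
    simp [hω]
  · refine tendstoInMeasure_mul_of_isBoundedInProbability ?_
      (isBoundedInProbability_inv_sqrt_mul_sum_fold hlaw hindep hsplit hsplit_indep (hZm k) (hZ k)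
        hZ₀ j)
    have hslope := tendstoInMeasure_slope hlaw hindep hsplit hsplit_indep hfold hgm hZm hg hZ hk i
    rw [tendstoInMeasure_iff_dist] at hslope ⊢
    simpa only [Real.dist_eq, sub_zero, abs_sub_comm] using hslope

theorem tendstoInDistribution_sqrt_mul_crossFit_sub [Finite κ] [Fintype ι]
    (hZ₀ : ∀ k, ∫ o, Z k o ∂L = 0) (hZZ : Pairwise fun k l => ∫ o, Z k o * Z l o ∂L = 0)
    (τ : κ → κ) :
    TendstoInDistribution (fun (n : ℕ) ω =>
        √(n : ℝ) * (crossFit g Z τ (split n ω) (fun i => obs i ω) - ∫ o, g o ∂L))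
      atTop id (fun _ => P) (gaussianReal 0 (⨅ w, Var[residual g Z w; L]).toNNReal) := by
  cases nonempty_fintype κ
  set w₀ := regressionCoeff g Z L
  have hclt := tendstoInDistribution_inv_sqrt_mul_sum_comp hlaw hindep
    (measurable_residual hgm hZm w₀) (memLp_residual hg hZ w₀)
  rw [integral_residual (hg.integrable one_le_two) (fun k => (hZ k).integrable one_le_two) hZ₀,
    ← iInf_variance_residual hg hZ hZZ hZ₀] at hclt
  refine tendstoInDistribution_of_tendstoInMeasure_sub _ _ hclt ?_ fun n => ?_
  · have hremainder := tendstoInMeasure_finsetSum_zero Finset.univ fun j _ =>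
      tendstoInMeasure_finsetSum_zero Finset.univ fun k _ =>
        tendstoInMeasure_slope_error_mul hlaw hindep hsplit hsplit_indep hfold hgm hZm hg hZ
          (hZ₀ k) (τ j) j
    refine hremainder.congr_left fun n => ae_of_all _ fun ω => ?_
    simp only [Pi.sub_apply, Finset.sum_range]
    exact (sqrt_mul_crossFit_sub g Z τ (split n ω) (fun i => obs i ω) w₀ _).symm
  · exact ((aemeasurable_comp_of_countable (hsplit n) (hasLaw_sample hlaw hindep n).aemeasurable
      (measurable_crossFit hgm hZm τ)).sub_const _).const_mul _

end Asymptotics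

section RandomSplit

variable {I O Ω κ ι : Type*} [Fintype I] [MeasurableSpace O] [MeasurableSpace Ω] [DecidableEq κ]
  [Finite κ] [MeasurableSpace κ] [MeasurableSingletonClass κ] {L : Measure O}
  [IsProbabilityMeasure L] {P : Measure Ω} {s : Ω → I → κ} {x : Ω → I → O}
  (hs : AEMeasurable s P) (hx : HasLaw x (Measure.pi fun _ => L) P)

include hs hx

theorem integrable_slope_fold {g z : O → ℝ} (hg : Measurable g) (hz : Measurable z)
    (hgz : Integrable (fun o => g o / z o) L) (j : κ) :
    Integrable (fun ω => slope g z (fold (s ω) j) (x ω)) P := by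
  have hdom : Integrable (fun x : I → O => ∑ i, |g (x i) / z (x i)|) (Measure.pi fun _ => L) :=
    integrable_sum_comp hgz.abs
  refine ((hx.map_eq ▸ hdom).comp_aemeasurable hx.aemeasurable).mono' ?_ (ae_of_all _ fun ω => ?_)
  · exact (aemeasurable_comp_of_countable hs hx.aemeasurable
      (Φ := fun s => slope g z (fold s j)) fun s => measurable_slope hg hz _).aestronglyMeasurable
  · exact (abs_slope_le g z _ _).trans
      (Finset.sum_le_univ_sum_of_nonneg fun _ => abs_nonneg _)

variable [Fintype ι] [IsProbabilityMeasure P] (hsx : IndepFun s x P) {τ : κ → κ}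
  (hτ : ∀ j, τ j ≠ j) {g : O → ℝ} {Z : ι → O → ℝ} (hgm : Measurable g)
  (hZm : ∀ k, Measurable (Z k)) (hg : Integrable g L) (hZ : ∀ k, Integrable (Z k) L)

include hsx hτ hgm hZm hg hZ

theorem integrable_crossFit_of_indepFun
    (hslope : ∀ j k, Integrable (fun ω => slope g (Z k) (fold (s ω) j) (x ω)) P) :
    Integrable (fun ω => crossFit g Z τ (s ω) (x ω)) P := by
  refine (integrable_comp_iff_of_indepFun hs hx hsx (measurable_crossFit hgm hZm τ)).2 ?_
  have hfix := fun j k => (integrable_comp_iff_of_indepFun hs hx hsx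
    (Φ := fun s => slope g (Z k) (fold s j)) fun s => measurable_slope hgm (hZm k) _).1 (hslope j k)
  filter_upwards [ae_all_iff.2 fun j => ae_all_iff.2 fun k => hfix j k] with ω hω
  exact integrable_crossFit hτ hgm hZm hg hZ hω

theorem integral_crossFit_of_indepFun [Nonempty I] (hZ₀ : ∀ k, ∫ o, Z k o ∂L = 0)
    (hint : Integrable (fun ω => crossFit g Z τ (s ω) (x ω)) P) :
    ∫ ω, crossFit g Z τ (s ω) (x ω) ∂P = ∫ o, g o ∂L := by
  have hm := measurable_crossFit (I := I) hgm hZm τ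
  have hfix := (integrable_comp_iff_of_indepFun hs hx hsx hm).1 hint
  calc ∫ ω, crossFit g Z τ (s ω) (x ω) ∂P
      = ∫ ω, ∫ y, crossFit g Z τ (s ω) y ∂(Measure.pi fun _ => L) ∂P :=
        integral_comp_of_indepFun hs hx hsx hm hint
    _ = ∫ _, ∫ o, g o ∂L ∂P :=
        integral_congr_ae (hfix.mono fun ω hω => integral_crossFit hτ hgm hZm hg hZ hZ₀ hω)
    _ = ∫ o, g o ∂L := by rw [integral_const, probReal_univ, one_smul]

end RandomSplit

end CrossFit

open CrossFit in
theorem lemma11_general {O Ω κ ι : Type*} [MeasurableSpace O] [MeasurableSpace Ω] [Finite κ]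
    [DecidableEq κ] [MeasurableSpace κ] [MeasurableSingletonClass κ] [Fintype ι]
    {L : Measure O} [IsProbabilityMeasure L] {g : O → ℝ} {Z : ι → O → ℝ} (hgm : Measurable g)
    (hZm : ∀ k, Measurable (Z k)) (hg : MemLp g 2 L) (hZ : ∀ k, MemLp (Z k) 2 L)
    (hZ₀ : ∀ k, ∫ o, Z k o ∂L = 0) (hZZ : Pairwise fun k l => ∫ o, Z k o * Z l o ∂L = 0)
    {τ : κ → κ} (hτ : ∀ j, τ j ≠ j) {P : Measure Ω} [IsProbabilityMeasure P] {obs : ℕ → Ω → O}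
    (hlaw : ∀ i, HasLaw (obs i) L P) (hindep : iIndepFun obs P) {split : ∀ n : ℕ, Ω → Fin n → κ}
    (hsplit : ∀ n, AEMeasurable (split n) P)
    (hsplit_indep : ∀ n, IndepFun (split n) (fun ω (i : Fin n) => obs i ω) P)
    (hfold : ∀ j m, Tendsto (fun n => P {ω | (fold (split n ω) j).card ≤ m}) atTop (nhds 0)) :
    (∀ n : ℕ, 1 ≤ n →
      Integrable (fun ω => crossFit g Z τ (split n ω) fun i => obs i ω) P →
      ∫ ω, crossFit g Z τ (split n ω) (fun i => obs i ω) ∂P = ∫ o, g o ∂L) ∧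
    (∀ n : ℕ,
      (∀ j k, Integrable (fun ω => slope g (Z k) (fold (split n ω) j) fun i => obs i ω) P) →
      Integrable (fun ω => crossFit g Z τ (split n ω) fun i => obs i ω) P) ∧
    ((∀ k, Integrable (fun o => g o / Z k o) L) → ∀ (n : ℕ) (j : κ) (k : ι),
      Integrable (fun ω => slope g (Z k) (fold (split n ω) j) fun i => obs i ω) P) ∧
    TendstoInDistribution (fun (n : ℕ) ω =>
        √(n : ℝ) * (crossFit g Z τ (split n ω) (fun i => obs i ω) - ∫ o, g o ∂L))
      atTop id (fun _ => P) (gaussianReal 0 (⨅ w, Var[residual g Z w; L]).toNNReal) := by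
  have hx := hasLaw_sample hlaw hindep
  have hg₁ := hg.integrable one_le_two
  have hZ₁ := fun k => (hZ k).integrable one_le_two
  refine ⟨fun n hn hint => ?_, fun n hslope => ?_, fun hgZ n j k => ?_, ?_⟩
  · have : Nonempty (Fin n) := Fin.pos_iff_nonempty.1 hn
    exact integral_crossFit_of_indepFun (hsplit n) (hx n) (hsplit_indep n) hτ hgm hZm hg₁ hZ₁ hZ₀
      hint
  · exact integrable_crossFit_of_indepFun (hsplit n) (hx n) (hsplit_indep n) hτ hgm hZm hg₁ hZ₁
      hslope
  · exact integrable_slope_fold (hsplit n) (hx n) hgm (hZm k) (hgZ k) j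
  · exact tendstoInDistribution_sqrt_mul_crossFit_sub hlaw hindep hsplit hsplit_indep hfold hgm hZm
      hg hZ hZ₀ hZZ τ

namespace SlateOPE

variable {K : ℕ} {d : Fin K → ℕ} {𝒳 : Type*} [MeasurableSpace 𝒳]

section LoggedData

instance (ν : Measure 𝒳) [IsProbabilityMeasure ν] (μ : ∀ k, Kernel 𝒳 (Fin (d k)))
    [∀ k, IsMarkovKernel (μ k)] (ρ : Kernel (𝒳 × Slate d) ℝ) [IsMarkovKernel ρ] :
    IsProbabilityMeasure (dataLaw ν μ ρ) := by
  unfold dataLaw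
  infer_instance

/-- The density ratio `π(a_k ∣ x) / μ_k(a_k ∣ x)` of slot `k` as a function of the context and the
action of that slot; `Y μ π k` is its value at the logged context and action. -/
noncomputable def ratio (μ : ∀ k, Kernel 𝒳 (Fin (d k))) (π : Kernel 𝒳 (Slate d)) (k : Fin K)
    (x : 𝒳) (a : Fin (d k)) : ℝ :=
  slotProb π k x a / (μ k x).real {a}

theorem measurable_ratio (μ : ∀ k, Kernel 𝒳 (Fin (d k))) (π : Kernel 𝒳 (Slate d)) (k : Fin K)
    (a : Fin (d k)) : Measurable fun x => ratio μ π k x a :=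
  (π.measurable_coe (Set.toFinite {b : Slate d | b k = a}).measurableSet).ennreal_toReal.div
    ((μ k).measurable_coe (measurableSet_singleton a)).ennreal_toReal

theorem measurable_ratio_apply (μ : ∀ k, Kernel 𝒳 (Fin (d k))) (π : Kernel 𝒳 (Slate d))
    (k : Fin K) : Measurable fun p : 𝒳 × Slate d => ratio μ π k p.1 (p.2 k) :=
  measurable_from_prod_countable_left fun a => measurable_ratio μ π k (a k)

@[fun_prop]
theorem measurable_Y (μ : ∀ k, Kernel 𝒳 (Fin (d k))) (π : Kernel 𝒳 (Slate d)) (k : Fin K) :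
    Measurable (Y μ π k) :=
  (measurable_ratio_apply μ π k).comp measurable_fst

theorem measurable_GR (μ : ∀ k, Kernel 𝒳 (Fin (d k))) (π : Kernel 𝒳 (Slate d)) :
    Measurable (GR μ π) := by
  unfold GR G
  fun_prop

theorem sum_slotProb (π : Kernel 𝒳 (Slate d)) [IsMarkovKernel π] (k : Fin K) (x : 𝒳) :
    ∑ a, slotProb π k x a = 1 := by
  have hk : Measurable fun b : Slate d => b k := measurable_pi_apply k
  have := Measure.isProbabilityMeasure_map (μ := π x) hk.aemeasurable
  calc ∑ a, slotProb π k x a = ∑ a, ((π x).map fun b => b k).real {a} :=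
        Finset.sum_congr rfl fun a _ =>
          (map_measureReal_apply hk (measurableSet_singleton a)).symm
    _ = 1 := by rw [sum_measureReal_singleton, Finset.coe_univ, probReal_univ]

variable {μ : ∀ k, Kernel 𝒳 (Fin (d k))} [∀ k, IsMarkovKernel (μ k)] {π : Kernel 𝒳 (Slate d)}

theorem integral_ratio_sub_one [IsMarkovKernel π] {k : Fin K} {x : 𝒳}
    (hx : ∀ a, μ k x {a} = 0 → slotProb π k x a = 0) :
    ∫ a, (ratio μ π k x (a k) - 1) ∂factored μ x = 0 := by
  have hcancel : ∀ c, (μ k x).real {c} • (ratio μ π k x c - 1)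
      = slotProb π k x c - (μ k x).real {c} := by
    intro c
    rw [ratio, smul_eq_mul, mul_sub, mul_one,
      mul_div_cancel_of_imp' fun hc => hx c ((measureReal_eq_zero_iff).1 hc)]
  calc ∫ a, (ratio μ π k x (a k) - 1) ∂factored μ x
      = ∫ c, (ratio μ π k x c - 1) ∂μ k x :=
        integral_comp_eval (μ := fun k => μ k x) (f := fun c => ratio μ π k x c - 1)
          (measurable_of_countable _).aestronglyMeasurable
    _ = ∑ c, (slotProb π k x c - (μ k x).real {c}) := by
        rw [integral_fintype .of_finite]
        simp only [hcancel]
    _ = 0 := by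
        rw [Finset.sum_sub_distrib, sum_slotProb, sum_measureReal_singleton, Finset.coe_univ,
          probReal_univ, sub_self]

theorem integral_ratio_sub_one_mul [IsMarkovKernel π] {k l : Fin K} (hkl : k ≠ l) {x : 𝒳}
    (hx : ∀ a, μ k x {a} = 0 → slotProb π k x a = 0) :
    ∫ a, (ratio μ π k x (a k) - 1) * (ratio μ π l x (a l) - 1) ∂factored μ x = 0 := by
  have hind : IndepFun (fun a : Slate d => ratio μ π k x (a k) - 1)
      (fun a => ratio μ π l x (a l) - 1) (factored μ x) :=
    (iIndepFun_pi (μ := fun k => μ k x) (X := fun k c => ratio μ π k x c - 1)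
      fun _ => (measurable_of_countable _).aemeasurable).indepFun hkl
  rw [hind.integral_fun_mul_eq_mul_integral (measurable_of_countable _).aestronglyMeasurable
    (measurable_of_countable _).aestronglyMeasurable, integral_ratio_sub_one hx, zero_mul]

variable {ν : Measure 𝒳} [IsProbabilityMeasure ν] {ρ : Kernel (𝒳 × Slate d) ℝ} [IsMarkovKernel ρ]

theorem integral_dataLaw_eq_zero {f : 𝒳 × Slate d → ℝ} (hf : Measurable f)
    (hint : Integrable (fun o : Obs 𝒳 d => f o.1) (dataLaw ν μ ρ))
    (hf₀ : ∀ᵐ x ∂ν, ∫ a, f (x, a) ∂factored μ x = 0) :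
    ∫ o, f o.1 ∂dataLaw ν μ ρ = 0 := by
  have hfst : (dataLaw ν μ ρ).map Prod.fst = ν ⊗ₘ factored μ :=
    Measure.fst_compProd (ν ⊗ₘ factored μ) ρ
  have hint' : Integrable f (ν ⊗ₘ factored μ) :=
    hfst ▸ (integrable_map_measure hf.aestronglyMeasurable measurable_fst.aemeasurable).2 hint
  rw [← integral_map (f := f) measurable_fst.aemeasurable hf.aestronglyMeasurable, hfst,
    Measure.integral_compProd hint', integral_eq_zero_of_ae hf₀]

variable [IsMarkovKernel π] (hcover : ∀ᵐ x ∂ν, ∀ k a, μ k x {a} = 0 → slotProb π k x a = 0)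

include hcover

theorem integral_Y_sub_one {k : Fin K} (hY : MemLp (Y μ π k) 2 (dataLaw ν μ ρ)) :
    ∫ o, (Y μ π k o - 1) ∂dataLaw ν μ ρ = 0 :=
  integral_dataLaw_eq_zero ((measurable_ratio_apply μ π k).sub_const 1)
    ((hY.integrable one_le_two).sub (integrable_const 1))
    (hcover.mono fun _ hx => integral_ratio_sub_one (hx k))

theorem integral_Y_sub_one_mul_Y_sub_one {k l : Fin K} (hkl : k ≠ l)
    (hYk : MemLp (Y μ π k) 2 (dataLaw ν μ ρ)) (hYl : MemLp (Y μ π l) 2 (dataLaw ν μ ρ)) :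
    ∫ o, (Y μ π k o - 1) * (Y μ π l o - 1) ∂dataLaw ν μ ρ = 0 :=
  integral_dataLaw_eq_zero
    (((measurable_ratio_apply μ π k).sub_const 1).mul
      ((measurable_ratio_apply μ π l).sub_const 1))
    ((hYk.sub (memLp_const 1)).integrable_mul (hYl.sub (memLp_const 1)))
    (hcover.mono fun _ hx => integral_ratio_sub_one_mul hkl (hx k))

end LoggedData

section Estimator

variable {n : ℕ}

omit [MeasurableSpace 𝒳] in
theorem card_mul_avg (D : Finset (Fin n)) (x : Fin n → Obs 𝒳 d) (f : Obs 𝒳 d → ℝ) :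
    D.card * avg D x f = ∑ i ∈ D, f (x i) := by
  rcases D.eq_empty_or_nonempty with rfl | hD
  · simp
  · exact mul_inv_cancel_left₀ (by simpa using hD.ne_empty) _

variable (μ : ∀ k, Kernel 𝒳 (Fin (d k))) (π : Kernel 𝒳 (Slate d)) (s : Fin n → Fin 3)
  (x : Fin n → Obs 𝒳 d)

theorem weight_eq_slope (j : Fin 3) (k : Fin K) :
    weight μ π s x j k
      = CrossFit.slope (GR μ π) (fun o => Y μ π k o - 1) (CrossFit.fold s j) x := by
  change _ = CrossFit.slope _ _ (fold s j) x
  rw [CrossFit.slope, weight]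
  rcases (fold s j).eq_empty_or_nonempty with h | h
  · simp [h, avg]
  · exact mul_div_mul_left _ _ (by simpa using h.ne_empty)

theorem thetaHat_eq_crossFit :
    thetaHat μ π s x = CrossFit.crossFit (GR μ π) (fun k o => Y μ π k o - 1) (· + 1) s x := by
  have hterm : ∀ j k, (fold s j).card / (n : ℝ) * weight μ π s x (j + 1) k *
      avg (fold s j) x (fun o => Y μ π k o - 1)
        = (n : ℝ)⁻¹ * (weight μ π s x (j + 1) k * ∑ i ∈ fold s j, (Y μ π k (x i) - 1)) := by
    intro j k
    rw [← card_mul_avg (fold s j) x fun o => Y μ π k o - 1]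
    ring
  rw [CrossFit.crossFit_eq _ _ _ s x 0, thetaHat, avg, Finset.sum_comm]
  simp only [hterm, ← Finset.mul_sum]
  simp only [weight_eq_slope, CrossFit.residual, Pi.zero_apply, zero_mul, Finset.sum_const_zero,
    sub_zero, zero_sub, neg_mul, Finset.sum_neg_distrib, ← sub_eq_add_neg, mul_sub,
    Finset.card_univ, Fintype.card_fin]
  rfl

theorem tendsto_measure_card_fold_le {Ω : Type*} [MeasurableSpace Ω] {P : Measure Ω}
    {split : ∀ n : ℕ, Ω → Fin n → Fin 3} (heven : ∀ n, ∀ᵐ ω ∂P, IsEvenSplit (split n ω))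
    (j : Fin 3) (m : ℕ) :
    Tendsto (fun n => P {ω | (CrossFit.fold (split n ω) j).card ≤ m}) atTop (nhds 0) := by
  refine tendsto_const_nhds.congr' ?_
  filter_upwards [eventually_ge_atTop (3 * (m + 1))] with n hn
  refine (measure_mono_null (fun ω hω => ?_) (heven n)).symm
  intro h
  have hlow : n / 3 ≤ m := (h j).1.trans hω
  omega

end Estimator

end SlateOPE

open SlateOPE in
theorem lemma11 {K : ℕ} {d : Fin K → ℕ} {𝒳 : Type*} [MeasurableSpace 𝒳]
    -- context law, slot-level logging policies, reward kernel, target policy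
    (ν : Measure 𝒳) [IsProbabilityMeasure ν]
    (μ : ∀ k, Kernel 𝒳 (Fin (d k))) [∀ k, IsMarkovKernel (μ k)]
    (ρ : Kernel (𝒳 × Slate d) ℝ) [IsMarkovKernel ρ]
    (π : Kernel 𝒳 (Slate d)) [IsMarkovKernel π]
    -- the logging policy covers, slot by slot, the actions of the target policy
    (hcover : ∀ᵐ x ∂ν, ∀ k a, μ k x {a} = 0 → slotProb π k x a = 0)
    -- finite second moments
    (hGR : MemLp (GR μ π) 2 (dataLaw ν μ ρ))
    (hY : ∀ k, MemLp (Y μ π k) 2 (dataLaw ν μ ρ))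
    -- i.i.d. observations
    {Ω : Type*} [MeasurableSpace Ω] (P : Measure Ω) [IsProbabilityMeasure P]
    (obs : ℕ → Ω → Obs 𝒳 d)
    (hlaw : ∀ i, HasLaw (obs i) (dataLaw ν μ ρ) P)
    (hindep : iIndepFun obs P)
    -- for every `n`, a random even split of the first `n` observations, independent of them
    (split : ∀ n : ℕ, Ω → Fin n → Fin 3)
    (hsplit_meas : ∀ n, AEMeasurable (split n) P)
    (hsplit_even : ∀ n, ∀ᵐ ω ∂P, IsEvenSplit (split n ω))
    (hsplit_indep : ∀ n, IndepFun (split n) (fun ω (i : Fin n) => obs i ω) P) :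
    -- unbiasedness for every `n ≥ 1` for which the estimator has an expectation
    (∀ n : ℕ, 1 ≤ n →
      Integrable (fun ω => thetaHat μ π (split n ω) (fun i => obs i ω)) P →
      ∫ ω, thetaHat μ π (split n ω) (fun i => obs i ω) ∂P = theta μ π (dataLaw ν μ ρ)) ∧
    -- the expectation exists if the fitted weights have expectations
    (∀ n : ℕ, 1 ≤ n →
      (∀ j k, Integrable (fun ω => weight μ π (split n ω) (fun i => obs i ω) j k) P) →
      Integrable (fun ω => thetaHat μ π (split n ω) (fun i => obs i ω)) P) ∧
    -- the weights have expectations, for every `n`, if `E[|GR| / |Y_k - 1| ; Y_k ≠ 1] < ∞`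
    ((∀ k, Integrable (fun o => GR μ π o / (Y μ π k o - 1)) (dataLaw ν μ ρ)) →
      ∀ (n : ℕ) (j : Fin 3) (k : Fin K),
        Integrable (fun ω => weight μ π (split n ω) (fun i => obs i ω) j k) P) ∧
    -- asymptotic normality
    TendstoInDistribution
      (fun (n : ℕ) ω => √(n : ℝ) *
        (thetaHat μ π (split n ω) (fun i => obs i ω) - theta μ π (dataLaw ν μ ρ)))
      atTop id (fun _ => P) (gaussianReal 0 (Vstar μ π (dataLaw ν μ ρ)).toNNReal) := by
  obtain ⟨hmean, hint, hweight, hclt⟩ := lemma11_general (measurable_GR μ π)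
    (fun k => (measurable_Y μ π k).sub_const 1) hGR (fun k => (hY k).sub (memLp_const 1))
    (fun k => integral_Y_sub_one hcover (hY k))
    (fun k l hkl => integral_Y_sub_one_mul_Y_sub_one hcover hkl (hY k) (hY l))
    (τ := (· + 1)) (by decide) hlaw hindep hsplit_meas hsplit_indep
    (tendsto_measure_card_fold_le hsplit_even)
  simp only [thetaHat_eq_crossFit, weight_eq_slope]
  exact ⟨hmean, fun n _ => hint n, hweight, hclt⟩
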